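/- Notation: $\|\cdot\|$ is the Euclidean norm on $\mathbb{R}^d$ and $B(R)$ the closed ball of radius $R>0$ centered at the origin. A first-order pair is an element of $\mathbb{R}\times\mathbb{R}^d$. A function $h$ on a set $D\subseteq\mathbb{R}^d$ is $M$-Lipschitz if $|h(x)-h(y)|\le M\|x-y\|$ for all $x,y\in D$, and $\alpha$-smooth if it is differentiable on $D$ with $\|\nabla h(x)-\nabla h(y)\|\le\alpha\|x-y\|$ for all $x,y\in D$ (at boundary points of $D=B(R)$, derivatives are taken relative to $B(R)$). For $\eta\ge 0$, an $\eta$-approximate first-order oracle for a convex $f:\mathbb{R}^d\to\mathbb{R}$ answers a query $\bar x\in\mathbb{R}^d$ with a first-order pair $(\tilde f,\tilde g)$ such that $|\tilde f-f(\bar x)|\le\eta$ and $\|\tilde g-g\|\le\frac{\eta}{2R}$ for some subgradient $g\in\partial f(\bar x)$; repeated queries at the same point may be answered differently. Given points $x_1,\dots,x_T\in B(R)$, first-order pairs $(\hat f_1,\hat g_1),\dots,(\hat f_T,\hat g_T)$ have $F:B(R)\to\mathbb{R}$ as an $M$-extension if $F$ is convex and $M$-Lipschitz and $F(x_t)=\hat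 f_t$, $\hat g_t\in\partial F(x_t)$ for all $t$. A procedure is online if its $t$-th output depends only on $x_1,\dots,x_t$ and on the oracle answers received up to round $t$. Theorem (online first-order smooth-extensibility). Let integers $d,T\ge 1$, reals $\alpha, M\ge 0$, $R>0$ and $0\le\eta\le\frac{\alpha R^2}{5T}$ be given. There is an online procedure with the following property. For every $\alpha$-smooth, $M$-Lipschitz convex function $f:\mathbb{R}^d\to\mathbb{R}$, every sequence $x_1,\dots,x_T\in B(R)$ and every $\eta$-approximate first-order oracle for $f$, the procedure, probing the oracle only at the given points $x_1,\dots,x_T$ (at $x_t$ in round $t$), produces first-order pairs $(\hat f_1,\hat g_1),\dots,(\hat f_T,\hat g_T)$ that have an $\alpha'$-smooth $\left(M+\frac{\eta}{2R}\right)$-extension $S:B(R)\to\mathbb{R}$ satisfying $\hat f_t=S(x_t)$ and $\hat g_t=\nabla S(x_t)$ for all $t$, and $$\sup_{x\in B(R)}|S(x)-f(x)|\le 5\eta\,(T+2),\qquad\text{where}\quad \alpha'=\alpha\sqrt{d}\,\left(4\sqrt{5(T+1)}+3\right).$$ -/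

import Mathlib

/-- A first-order pair in dimension `d`: a value and a (sub)gradient. -/
abbrev FirstOrderPair (d : ℕ) : Type := ℝ × EuclideanSpace ℝ (Fin d)

/-- `h` is `M`-Lipschitz on `s`, with respect to the Euclidean norm. -/
def IsLipOn {d : ℕ} (M : ℝ) (s : Set (EuclideanSpace ℝ (Fin d)))
    (h : EuclideanSpace ℝ (Fin d) → ℝ) : Prop :=
  ∀ x ∈ s, ∀ y ∈ s, |h x - h y| ≤ M * ‖x - y‖

/-- `h`, regarded as a function on `s`, is `α`-smooth: it is differentiable on `s`
and its gradient map is `α`-Lipschitz on `s`. -/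
def IsSmoothOn {d : ℕ} (α : ℝ) (s : Set (EuclideanSpace ℝ (Fin d)))
    (h : EuclideanSpace ℝ (Fin d) → ℝ) : Prop :=
  ∃ G : EuclideanSpace ℝ (Fin d) → EuclideanSpace ℝ (Fin d),
    (∀ x ∈ s, HasGradientWithinAt h (G x) s x) ∧
    ∀ x ∈ s, ∀ y ∈ s, ‖G x - G y‖ ≤ α * ‖x - y‖

/-- The subdifferential at `x` of `h`, regarded as a function on `s`. -/
def subdifferentialOn {d : ℕ} (s : Set (EuclideanSpace ℝ (Fin d)))
    (h : EuclideanSpace ℝ (Fin d) → ℝ) (x : EuclideanSpace ℝ (Fin d)) :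
    Set (EuclideanSpace ℝ (Fin d)) :=
  {g | ∀ y ∈ s, h x + inner ℝ g (y - x) ≤ h y}

/-- `O` is an `η`-approximate first-order oracle for `f : ℝ^d → ℝ` (relative to the radius `R`). -/
def IsApproxOracle {d : ℕ} (η R : ℝ) (f : EuclideanSpace ℝ (Fin d) → ℝ)
    (O : EuclideanSpace ℝ (Fin d) → FirstOrderPair d) : Prop :=
  ∀ x, |(O x).1 - f x| ≤ η ∧
    ∃ g ∈ subdifferentialOn Set.univ f x, ‖(O x).2 - g‖ ≤ η / (2 * R)

/-- The first-order pairs `p` at the points `x` have `F`, regarded as a function on `s`, as an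
`M`-Lipschitz convex extension. -/
structure IsLipConvexExtension {d T : ℕ} (M : ℝ) (s : Set (EuclideanSpace ℝ (Fin d)))
    (x : Fin T → EuclideanSpace ℝ (Fin d)) (p : Fin T → FirstOrderPair d)
    (F : EuclideanSpace ℝ (Fin d) → ℝ) : Prop where
  convexOn : ConvexOn ℝ s F
  lipschitz : IsLipOn M s F
  value_eq : ∀ t, F (x t) = (p t).1
  mem_subdifferential : ∀ t, (p t).2 ∈ subdifferentialOn s F (x t)

/-- A (deterministic) online procedure that probes the oracle exactly once per round, at the point
of that round: in round `t` (counted from `0`) its output is a function of the points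
`x_0, …, x_t` and of the oracle's answers at these points. -/
def OnlineProcedure (d : ℕ) : Type :=
  (t : ℕ) → (Fin (t + 1) → EuclideanSpace ℝ (Fin d)) → (Fin (t + 1) → FirstOrderPair d) →
    FirstOrderPair d

/-- The pair which the procedure outputs in round `t`, when it is run on the points `x` and
the oracle answers a query `z` in round `i` by `O i z`. -/
def OnlineProcedure.output {d T : ℕ} (P : OnlineProcedure d)
    (x : Fin T → EuclideanSpace ℝ (Fin d))
    (O : Fin T → EuclideanSpace ℝ (Fin d) → FirstOrderPair d) (t : Fin T) : FirstOrderPair d :=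
  P t (fun i => x (Fin.castLE t.isLt i))
    (fun i => O (Fin.castLE t.isLt i) (x (Fin.castLE t.isLt i)))

/-!
The idea is to replace the maximum of affine functions by a smooth one. For affine functions
`l i = a i + ⟪g i, ·⟫` put `Φ(x, v) = sup_i (l i x + μ / 2 * ‖g i - v‖ ^ 2)` and
`S x = min_v Φ(x, v)`. This is a Moreau envelope in disguise: `S` is convex, lies above every `l i`,
its gradient at `x` is the minimizing `v`, and this gradient is `μ⁻¹`-Lipschitz. All of it follows
from the strong convexity of `Φ(x, ·)` and from `penalizedSup_add_le`, which compares `Φ` at two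
points.

The answer of round `s` (counted from `0`) defines an affine function, which is lowered by `5ηs`.
The procedure outputs, in round `t`, the value and the gradient at `x t` of the smooth maximum of
the affine functions received so far, with `μ⁻¹ = αq` and `q = 4√(5(T + 1)) + 3`. The extension is
the smooth maximum of all these functions together with all tangents of `f`, lowered by `5ηT`. The
tangents give the lower bound on the extension. For the upper bound, smoothness of `f` shows that
the affine functions exceed `f` by at most `5η/2` even when they are increased by
`‖g i - ∇f x‖ ^ 2 / (4α)` (`affine_add_sq_le`), which is more than the penalty at `v = ∇f x`.

What remains is that later functions do not change the value and the gradient `v` of the smooth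
maximum at `x t`, for which it suffices that their penalized values `l k (x t) + μ/2 ‖g k - v‖ ^ 2`
are at most that of the function of round `t` (`smoothMax_eq_of_subfamily`). The smooth maximum
inherits the improved upper bound of its members (`smoothMax_add_sq_le`), whence
`‖v - ∇f (x t)‖ ^ 2 ≤ 20αηT`; with `q ^ 2 ≥ 80T` the change of the penalty is then `O(η)`, and it is
absorbed by the difference of at least `5η` between the amounts by which the functions are lowered
(`penalized_le_penalized`). This argument does not depend on the dimension: the factor `√d` in the
claim is not needed, except that for `d = 0` both sides vanish.
-/

/-! ### The smooth maximum of a family of affine functions -/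

section SmoothMax

variable {E ι : Type*} [NormedAddCommGroup E] [InnerProductSpace ℝ E]

/-- The supremum over `i` of the affine functions `a i + ⟪g i, ·⟫` at `x`, each one increased by
`μ / 2` times the squared distance of its slope to `v`. Its minimum over `v` is the Moreau envelope
(with parameter `μ`) of the supremum of the functions `a i + ⟪g i, ·⟫ + μ / 2 * ‖g i‖ ^ 2`,
and the minimizing `v` is the gradient of that envelope. -/
noncomputable def penalizedSup (μ : ℝ) (a : ι → ℝ) (g : ι → E) (x v : E) : ℝ :=
  ⨆ i, (a i + inner ℝ (g i) x + μ / 2 * ‖g i - v‖ ^ 2)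

/-- All the suprema in `penalizedSup μ a g` are finite. -/
def IsPenaltyBounded (μ : ℝ) (a : ι → ℝ) (g : ι → E) : Prop :=
  ∀ x v, BddAbove (Set.range fun i => a i + inner ℝ (g i) x + μ / 2 * ‖g i - v‖ ^ 2)

/-- A minimizer of `penalizedSup μ a g x`; it turns out to be the gradient at `x`
of `smoothMax μ a g`. -/
noncomputable def smoothMaxGrad (μ : ℝ) (a : ι → ℝ) (g : ι → E) (x : E) : E :=
  Classical.epsilon fun v => ∀ w, penalizedSup μ a g x v ≤ penalizedSup μ a g x w

/-- The smooth maximum of the affine functions `a i + ⟪g i, ·⟫`: a convex function above all of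
them whose gradient is `μ⁻¹`-Lipschitz. -/
noncomputable def smoothMax (μ : ℝ) (a : ι → ℝ) (g : ι → E) (x : E) : ℝ :=
  penalizedSup μ a g x (smoothMaxGrad μ a g x)

variable {μ : ℝ} {a : ι → ℝ} {g : ι → E}

theorem isPenaltyBounded_of_finite [Finite ι] : IsPenaltyBounded μ a g :=
  fun _ _ => (Set.finite_range _).bddAbove

theorem isPenaltyBounded_of_norm_le (hμ : 0 ≤ μ) {C B : ℝ} (hg : ∀ i, ‖g i‖ ≤ C)
    (ha : ∀ i, a i ≤ B) : IsPenaltyBounded μ a g := by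
  intro x v
  refine ⟨B + C * ‖x‖ + μ / 2 * (C + ‖v‖) ^ 2, ?_⟩
  rintro _ ⟨i, rfl⟩
  have h1 : inner ℝ (g i) x ≤ C * ‖x‖ :=
    (real_inner_le_norm _ _).trans (mul_le_mul_of_nonneg_right (hg i) (norm_nonneg _))
  have h2 : ‖g i - v‖ ≤ C + ‖v‖ := (norm_sub_le _ _).trans (by linarith [hg i])
  have h3 : μ / 2 * ‖g i - v‖ ^ 2 ≤ μ / 2 * (C + ‖v‖) ^ 2 := by gcongr
  have := ha i
  simp only
  linarith

theorem le_penalizedSup (hb : IsPenaltyBounded μ a g) (x v : E) (i : ι) :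
    a i + inner ℝ (g i) x + μ / 2 * ‖g i - v‖ ^ 2 ≤ penalizedSup μ a g x v :=
  le_ciSup (hb x v) i

theorem le_smoothMax (hμ : 0 < μ) (hb : IsPenaltyBounded μ a g) (x : E) (i : ι) :
    a i + inner ℝ (g i) x ≤ smoothMax μ a g x := by
  have h1 := le_penalizedSup hb x (smoothMaxGrad μ a g x) i
  have h2 : 0 ≤ μ / 2 * ‖g i - smoothMaxGrad μ a g x‖ ^ 2 := by positivity
  rw [smoothMax]
  linarith

variable [Nonempty ι]

theorem penalizedSup_le {x v : E} {c : ℝ}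
    (h : ∀ i, a i + inner ℝ (g i) x + μ / 2 * ‖g i - v‖ ^ 2 ≤ c) :
    penalizedSup μ a g x v ≤ c :=
  ciSup_le h

/-- `penalizedSup μ a g x` is `μ`-strongly convex. -/
theorem penalizedSup_lineMap_le (hb : IsPenaltyBounded μ a g) (x v w : E) {s : ℝ}
    (hs : 0 ≤ s) (hs' : s ≤ 1) :
    penalizedSup μ a g x (v + s • (w - v)) ≤ (1 - s) * penalizedSup μ a g x v
      + s * penalizedSup μ a g x w - μ / 2 * (s * (1 - s) * ‖w - v‖ ^ 2) := by
  refine penalizedSup_le fun i => ?_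
  have h1 := mul_le_mul_of_nonneg_left (le_penalizedSup hb x v i) (sub_nonneg.2 hs')
  have h2 := mul_le_mul_of_nonneg_left (le_penalizedSup hb x w i) hs
  have h3 : ‖g i - (v + s • (w - v))‖ ^ 2 = (1 - s) * ‖g i - v‖ ^ 2 + s * ‖g i - w‖ ^ 2
      - s * (1 - s) * ‖w - v‖ ^ 2 := by
    have e1 : g i - (v + s • (w - v)) = (g i - v) - s • (w - v) := by abel
    have e2 : g i - w = (g i - v) - (w - v) := by abel
    rw [e1, e2, norm_sub_sq_real, norm_sub_sq_real (g i - v), norm_smul, inner_smul_right,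
      mul_pow, Real.norm_eq_abs, sq_abs]
    ring
  rw [h3]
  linear_combination h1 + h2

theorem continuous_penalizedSup [FiniteDimensional ℝ E] (hμ : 0 ≤ μ)
    (hb : IsPenaltyBounded μ a g) (x : E) : Continuous (penalizedSup μ a g x) := by
  have hc : ConvexOn ℝ Set.univ (penalizedSup μ a g x) := by
    refine ⟨convex_univ, fun v _ w _ r s hr hs hrs => ?_⟩
    have h := penalizedSup_lineMap_le hb x v w hs (by linarith)
    have h2 : 0 ≤ μ / 2 * (s * (1 - s) * ‖w - v‖ ^ 2) := by
      have : 0 ≤ 1 - s := by linarith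
      positivity
    obtain rfl : r = 1 - s := by linarith
    have h3 : (1 - s) • v + s • w = v + s • (w - v) := by module
    rw [h3, smul_eq_mul, smul_eq_mul]
    linarith
  exact continuousOn_univ.1 (hc.continuousOn isOpen_univ)

theorem penalizedSup_smoothMaxGrad_le [FiniteDimensional ℝ E] (hμ : 0 < μ)
    (hb : IsPenaltyBounded μ a g) (x w : E) :
    penalizedSup μ a g x (smoothMaxGrad μ a g x) ≤ penalizedSup μ a g x w := by
  have hex : ∃ v, ∀ w, penalizedSup μ a g x v ≤ penalizedSup μ a g x w := by
    obtain ⟨i⟩ := ‹Nonempty ι›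
    refine (continuous_penalizedSup hμ.le hb x).exists_forall_le' (g i) ?_
    have hlim : Filter.Tendsto
        (fun v => a i + inner ℝ (g i) x + μ / 2 * ‖g i - v‖ ^ 2)
        (Filter.cocompact E) Filter.atTop := by
      refine Filter.tendsto_atTop_add_const_left _ _ ?_
      refine Filter.Tendsto.const_mul_atTop (by positivity) ?_
      refine (Filter.tendsto_pow_atTop two_ne_zero).comp ?_
      simpa only [dist_eq_norm, norm_sub_rev] using tendsto_dist_right_cocompact_atTop (g i)
    filter_upwards [hlim.eventually_ge_atTop (penalizedSup μ a g x (g i))] with v hv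
    exact hv.trans (le_penalizedSup hb x v i)
  exact Classical.epsilon_spec hex w

/-- A minimizer of a strongly convex function is a minimizer with quadratic growth. -/
theorem penalizedSup_add_sq_le {x v : E} (hb : IsPenaltyBounded μ a g)
    (hv : ∀ w, penalizedSup μ a g x v ≤ penalizedSup μ a g x w) (w : E) :
    penalizedSup μ a g x v + μ / 2 * ‖w - v‖ ^ 2 ≤ penalizedSup μ a g x w := by
  have key : ∀ s ∈ Set.Ioc (0 : ℝ) 1, penalizedSup μ a g x v
      + μ / 2 * ((1 - s) * ‖w - v‖ ^ 2) ≤ penalizedSup μ a g x w := by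
    rintro s ⟨hs, hs'⟩
    have h := (hv _).trans (penalizedSup_lineMap_le hb x v w hs.le hs')
    refine le_of_mul_le_mul_left ?_ hs
    linear_combination h
  have hlim : Filter.Tendsto (fun s : ℝ => penalizedSup μ a g x v
      + μ / 2 * ((1 - s) * ‖w - v‖ ^ 2)) (nhdsWithin 0 (Set.Ioi 0))
      (nhds (penalizedSup μ a g x v + μ / 2 * ((1 - 0) * ‖w - v‖ ^ 2))) :=
    tendsto_nhdsWithin_of_tendsto_nhds (Continuous.tendsto (by fun_prop) _)
  rw [sub_zero, one_mul] at hlim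
  refine le_of_tendsto hlim ?_
  filter_upwards [Ioc_mem_nhdsGT (zero_lt_one' ℝ)] with s hs using key s hs

theorem penalizedSup_add_le (hμ : 0 < μ) (hb : IsPenaltyBounded μ a g) (x h v : E) :
    penalizedSup μ a g (x + h) (v + μ⁻¹ • h) ≤
      penalizedSup μ a g x v + inner ℝ v h + μ⁻¹ / 2 * ‖h‖ ^ 2 := by
  refine penalizedSup_le fun i => ?_
  have h1 := le_penalizedSup hb x v i
  have e : g i - (v + μ⁻¹ • h) = (g i - v) - μ⁻¹ • h := by abel
  have h2 : μ / 2 * ‖g i - (v + μ⁻¹ • h)‖ ^ 2 = μ / 2 * ‖g i - v‖ ^ 2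
      - inner ℝ (g i) h + inner ℝ v h + μ⁻¹ / 2 * ‖h‖ ^ 2 := by
    rw [e, norm_sub_sq_real, norm_smul, inner_smul_right, mul_pow, Real.norm_eq_abs, sq_abs,
      inner_sub_left]
    field_simp
    ring
  rw [h2, inner_add_right]
  linarith

section FiniteDimensional

variable [FiniteDimensional ℝ E]

theorem smoothMax_le_penalizedSup (hμ : 0 < μ) (hb : IsPenaltyBounded μ a g) (x w : E) :
    smoothMax μ a g x ≤ penalizedSup μ a g x w :=
  penalizedSup_smoothMaxGrad_le hμ hb x w

theorem smoothMax_le_smoothMax_add (hμ : 0 < μ) (hb : IsPenaltyBounded μ a g) (x y : E) :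
    smoothMax μ a g y ≤ smoothMax μ a g x + inner ℝ (smoothMaxGrad μ a g x) (y - x)
      + μ⁻¹ / 2 * ‖y - x‖ ^ 2 := by
  have h := penalizedSup_add_le hμ hb x (y - x) (smoothMaxGrad μ a g x)
  rw [add_sub_cancel] at h
  exact (smoothMax_le_penalizedSup hμ hb y _).trans h

theorem smoothMax_add_inner_add_sq_le (hμ : 0 < μ) (hb : IsPenaltyBounded μ a g) (x y : E) :
    smoothMax μ a g x + inner ℝ (smoothMaxGrad μ a g x) (y - x)
      + μ / 2 * ‖smoothMaxGrad μ a g y - smoothMaxGrad μ a g x‖ ^ 2 ≤ smoothMax μ a g y := by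
  set v := smoothMaxGrad μ a g x
  set w := smoothMaxGrad μ a g y with hw
  set h := y - x with hh
  have h1 := penalizedSup_add_le hμ hb y (-h) w
  have h2 := penalizedSup_add_sq_le hb (penalizedSup_smoothMaxGrad_le hμ hb x) (w + μ⁻¹ • -h)
  rw [show y + -h = x by rw [hh]; abel] at h1
  have e : w + μ⁻¹ • -h - smoothMaxGrad μ a g x = (w - v) - μ⁻¹ • h := by
    rw [smul_neg]; simp only [v]; abel
  have h3 : μ / 2 * ‖w + μ⁻¹ • -h - smoothMaxGrad μ a g x‖ ^ 2 = μ / 2 * ‖w - v‖ ^ 2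
      - inner ℝ w h + inner ℝ v h + μ⁻¹ / 2 * ‖h‖ ^ 2 := by
    rw [e, norm_sub_sq_real, norm_smul, inner_smul_right, mul_pow, Real.norm_eq_abs, sq_abs,
      inner_sub_left]
    field_simp
    ring
  rw [h3] at h2
  rw [inner_neg_right, norm_neg] at h1
  change smoothMax μ a g x + _ ≤ _ at h2
  change _ ≤ smoothMax μ a g y + _ + _ at h1
  linarith

theorem smoothMax_add_inner_le (hμ : 0 < μ) (hb : IsPenaltyBounded μ a g) (x y : E) :
    smoothMax μ a g x + inner ℝ (smoothMaxGrad μ a g x) (y - x) ≤ smoothMax μ a g y := by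
  have h := smoothMax_add_inner_add_sq_le hμ hb x y
  have : 0 ≤ μ / 2 * ‖smoothMaxGrad μ a g y - smoothMaxGrad μ a g x‖ ^ 2 := by positivity
  linarith

theorem norm_smoothMaxGrad_sub_le (hμ : 0 < μ) (hb : IsPenaltyBounded μ a g) (x y : E) :
    ‖smoothMaxGrad μ a g x - smoothMaxGrad μ a g y‖ ≤ μ⁻¹ * ‖x - y‖ := by
  have h1 := smoothMax_add_inner_add_sq_le hμ hb x y
  have h2 := smoothMax_add_inner_add_sq_le hμ hb y x
  set v := smoothMaxGrad μ a g x
  set w := smoothMaxGrad μ a g y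
  have h3 : inner ℝ (v - w) (x - y) = -inner ℝ v (y - x) - inner ℝ w (x - y) := by
    rw [inner_sub_left, ← neg_sub y x, inner_neg_right, inner_neg_right]
  have h4 := real_inner_le_norm (v - w) (x - y)
  rw [norm_sub_rev w v] at h1
  have h5 : μ * ‖v - w‖ * ‖v - w‖ ≤ ‖x - y‖ * ‖v - w‖ := by nlinarith
  rw [inv_mul_eq_div, le_div_iff₀ hμ]
  rcases (norm_nonneg (v - w)).eq_or_lt with h0 | h0
  · rw [← h0, zero_mul]; positivity
  · linarith [le_of_mul_le_mul_right h5 h0]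

theorem convexOn_smoothMax (hμ : 0 < μ) (hb : IsPenaltyBounded μ a g) :
    ConvexOn ℝ Set.univ (smoothMax μ a g) := by
  refine ⟨convex_univ, fun x _ y _ r s hr hs hrs => ?_⟩
  set z := r • x + s • y with hz
  have h1 := mul_le_mul_of_nonneg_left (smoothMax_add_inner_le hμ hb z x) hr
  have h2 := mul_le_mul_of_nonneg_left (smoothMax_add_inner_le hμ hb z y) hs
  have h3 : r * inner ℝ (smoothMaxGrad μ a g z) (x - z)
      + s * inner ℝ (smoothMaxGrad μ a g z) (y - z) = 0 := by
    rw [← inner_smul_right, ← inner_smul_right, ← inner_add_right]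
    have : r • (x - z) + s • (y - z) = 0 := by
      have : r • (x - z) + s • (y - z) = r • x + s • y - (r + s) • z := by module
      rw [this, hrs, one_smul, hz, sub_self]
    rw [this, inner_zero_right]
  have h4 : smoothMax μ a g z = (r + s) * smoothMax μ a g z := by rw [hrs, one_mul]
  rw [smul_eq_mul, smul_eq_mul]
  linarith

theorem hasGradientAt_smoothMax [CompleteSpace E] (hμ : 0 < μ) (hb : IsPenaltyBounded μ a g)
    (x : E) : HasGradientAt (smoothMax μ a g) (smoothMaxGrad μ a g x) x := by
  rw [hasGradientAt_iff_isLittleO]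
  have h1 : (fun y => smoothMax μ a g y - smoothMax μ a g x
      - inner ℝ (smoothMaxGrad μ a g x) (y - x)) =O[nhds x] fun y => ‖y - x‖ ^ 2 := by
    refine Asymptotics.IsBigO.of_bound (μ⁻¹ / 2) (Filter.Eventually.of_forall fun y => ?_)
    have h1 := smoothMax_le_smoothMax_add hμ hb x y
    have h2 := smoothMax_add_inner_le hμ hb x y
    rw [Real.norm_eq_abs, Real.norm_eq_abs, abs_of_nonneg (by linarith),
      abs_of_nonneg (by positivity)]
    linarith
  refine h1.trans_isLittleO ?_
  have h2 : (fun h : E => ‖h‖ ^ 2) =o[nhds 0] fun h => h :=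
    Asymptotics.isLittleO_norm_pow_id one_lt_two
  have h3 : Filter.Tendsto (fun y => y - x) (nhds x) (nhds 0) := by
    have : Continuous fun y : E => y - x := by fun_prop
    simpa using this.tendsto x
  exact h2.comp_tendsto h3

theorem abs_smoothMax_sub_le (hμ : 0 < μ) (hb : IsPenaltyBounded μ a g) {C : ℝ}
    (hg : ∀ i, ‖g i‖ ≤ C) (x y : E) :
    |smoothMax μ a g x - smoothMax μ a g y| ≤ C * ‖x - y‖ := by
  have key : ∀ x y : E, smoothMax μ a g x ≤ smoothMax μ a g y + C * ‖x - y‖ := by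
    intro x y
    refine (smoothMax_le_penalizedSup hμ hb x (smoothMaxGrad μ a g y)).trans
      (penalizedSup_le fun i => ?_)
    have h1 := le_penalizedSup hb y (smoothMaxGrad μ a g y) i
    have h2 : inner ℝ (g i) (x - y) ≤ C * ‖x - y‖ :=
      (real_inner_le_norm _ _).trans (mul_le_mul_of_nonneg_right (hg i) (norm_nonneg _))
    rw [inner_sub_right] at h2
    rw [smoothMax]
    linarith
  rw [abs_sub_le_iff]
  have h := key y x
  rw [norm_sub_rev] at h
  constructor <;> linarith [key x y]

/-- If each affine function, increased by `κ / 2` times the squared distance of its slope to `p`,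
is at most `B` at `x`, then the same holds for the smooth maximum and its gradient. -/
theorem smoothMax_add_sq_le (hμ : 0 < μ) (hb : IsPenaltyBounded μ a g) {κ B : ℝ} (hκ : μ ≤ κ)
    {x p : E} (h : ∀ i, a i + inner ℝ (g i) x + κ / 2 * ‖g i - p‖ ^ 2 ≤ B) :
    smoothMax μ a g x + κ / 2 * ‖smoothMaxGrad μ a g x - p‖ ^ 2 ≤ B := by
  set v := smoothMaxGrad μ a g x with hv
  set D := v - p with hD
  -- This multiple of `D` makes the terms of second order in the slopes cancel exactly.
  have h1 := penalizedSup_add_sq_le hb (penalizedSup_smoothMaxGrad_le hμ hb x)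
    (v - (κ / μ) • D)
  have h2 : penalizedSup μ a g x (v - (κ / μ) • D) ≤
      B + κ * (κ - μ) / (2 * μ) * ‖D‖ ^ 2 := by
    refine penalizedSup_le fun i => ?_
    have e : g i - (v - (κ / μ) • D) = (g i - p) + ((κ - μ) / μ) • D := by
      have : (κ - μ) / μ = κ / μ - 1 := by field_simp
      rw [this, hD]; module
    have h3 : 0 ≤ (κ - μ) / 2 * ‖(g i - p) - D‖ ^ 2 :=
      mul_nonneg (by linarith) (by positivity)
    have h4 : μ / 2 * ‖g i - (v - (κ / μ) • D)‖ ^ 2 = κ / 2 * ‖g i - p‖ ^ 2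
        + κ * (κ - μ) / (2 * μ) * ‖D‖ ^ 2 - (κ - μ) / 2 * ‖(g i - p) - D‖ ^ 2 := by
      rw [e, norm_add_sq_real, norm_sub_sq_real (g i - p) D, norm_smul, inner_smul_right, mul_pow,
        Real.norm_eq_abs, sq_abs]
      field_simp
      ring
    linarith [h i]
  have h5 : μ / 2 * ‖v - (κ / μ) • D - smoothMaxGrad μ a g x‖ ^ 2
      = κ ^ 2 / (2 * μ) * ‖D‖ ^ 2 := by
    rw [← hv, sub_sub_cancel_left, norm_neg, norm_smul, mul_pow, Real.norm_eq_abs, sq_abs]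
    field_simp
  rw [h5] at h1
  change smoothMax μ a g x + _ ≤ _ at h1
  have h6 : κ * (κ - μ) / (2 * μ) * ‖D‖ ^ 2 = κ ^ 2 / (2 * μ) * ‖D‖ ^ 2 - κ / 2 * ‖D‖ ^ 2 := by
    field_simp
  linarith

/-- Enlarging the family does not change the smooth maximum and its gradient at `x` if the new
affine functions, penalized at the old gradient, stay below the old smooth maximum. -/
theorem smoothMax_eq_of_subfamily {ι' : Type*} [Nonempty ι'] {a' : ι' → ℝ} {g' : ι' → E}
    (hμ : 0 < μ) (hb : IsPenaltyBounded μ a g) (hb' : IsPenaltyBounded μ a' g')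
    (e : ι → ι') (ha : ∀ i, a' (e i) = a i) (hg : ∀ i, g' (e i) = g i) {x : E}
    (h : ∀ k, a' k + inner ℝ (g' k) x + μ / 2 * ‖g' k - smoothMaxGrad μ a g x‖ ^ 2 ≤
      smoothMax μ a g x) :
    smoothMax μ a' g' x = smoothMax μ a g x ∧
      smoothMaxGrad μ a' g' x = smoothMaxGrad μ a g x := by
  set v := smoothMaxGrad μ a g x
  set w := smoothMaxGrad μ a' g' x
  have h1 : penalizedSup μ a' g' x v ≤ smoothMax μ a g x := penalizedSup_le h
  have h2 : penalizedSup μ a g x w ≤ penalizedSup μ a' g' x w := by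
    refine penalizedSup_le fun i => ?_
    rw [← ha, ← hg]
    exact le_penalizedSup hb' x w (e i)
  have h3 : smoothMax μ a g x + μ / 2 * ‖w - v‖ ^ 2 ≤ penalizedSup μ a g x w :=
    penalizedSup_add_sq_le hb (penalizedSup_smoothMaxGrad_le hμ hb x) w
  have h4 : smoothMax μ a' g' x ≤ penalizedSup μ a' g' x v :=
    smoothMax_le_penalizedSup hμ hb' x v
  have h5 : smoothMax μ a' g' x = penalizedSup μ a' g' x w := rfl
  have h6 : 0 ≤ μ / 2 * ‖w - v‖ ^ 2 := by positivity
  refine ⟨by linarith, ?_⟩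
  have h7 : μ / 2 * ‖w - v‖ ^ 2 = 0 := by linarith
  have h8 : ‖w - v‖ ^ 2 = 0 := by
    rcases mul_eq_zero.1 h7 with h | h
    · linarith
    · exact h
  exact sub_eq_zero.1 (norm_eq_zero.1 (pow_eq_zero_iff two_ne_zero |>.1 h8))

end FiniteDimensional

end SmoothMax

/-! ### Smooth convex functions -/

section SmoothConvex

variable {d : ℕ} {α : ℝ} {f : EuclideanSpace ℝ (Fin d) → ℝ}
  {G : EuclideanSpace ℝ (Fin d) → EuclideanSpace ℝ (Fin d)}

theorem hasDerivAt_comp_add_smul (hG : ∀ x, HasGradientAt f (G x) x)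
    (x v : EuclideanSpace ℝ (Fin d)) (s : ℝ) :
    HasDerivAt (fun s : ℝ => f (x + s • v)) (inner ℝ (G (x + s • v)) v) s := by
  have h1 := (hG (x + s • v)).hasFDerivAt
  have h2 : HasDerivAt (fun s : ℝ => x + s • v) v s := by
    simpa using ((hasDerivAt_id s).smul_const v).const_add x
  exact (h1.comp_hasDerivAt s h2).congr_deriv (by simp)

/-- A function with `α`-Lipschitz gradient is bounded above by a quadratic touching it. -/
theorem le_add_inner_add_sq (hG : ∀ x, HasGradientAt f (G x) x)
    (hL : ∀ x y, ‖G x - G y‖ ≤ α * ‖x - y‖) (x v : EuclideanSpace ℝ (Fin d)) :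
    f (x + v) ≤ f x + inner ℝ (G x) v + α / 2 * ‖v‖ ^ 2 := by
  have h1 : ∀ s : ℝ, HasDerivAt (fun s : ℝ => f (x + s • v)
      - (s * inner ℝ (G x) v + α / 2 * ‖v‖ ^ 2 * s ^ 2))
      (inner ℝ (G (x + s • v)) v - (inner ℝ (G x) v + α * s * ‖v‖ ^ 2)) s := by
    intro s
    have := (hasDerivAt_comp_add_smul hG x v s).sub
      (((hasDerivAt_id s).mul_const (inner ℝ (G x) v)).add
        (((hasDerivAt_id s).pow 2).const_mul (α / 2 * ‖v‖ ^ 2)))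
    refine this.congr_deriv ?_
    simp
    ring
  have h2 : AntitoneOn (fun s : ℝ => f (x + s • v)
      - (s * inner ℝ (G x) v + α / 2 * ‖v‖ ^ 2 * s ^ 2)) (Set.Icc 0 1) := by
    refine antitoneOn_of_deriv_nonpos (convex_Icc 0 1)
      (fun s _ => (h1 s).continuousAt.continuousWithinAt)
      (fun s _ => (h1 s).differentiableAt.differentiableWithinAt) fun s hs => ?_
    rw [interior_Icc] at hs
    rw [(h1 s).deriv]
    have h3 := real_inner_le_norm (G (x + s • v) - G x) v
    have h4 := hL (x + s • v) x
    rw [add_sub_cancel_left, norm_smul, Real.norm_eq_abs, abs_of_pos hs.1] at h4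
    have h5 := mul_le_mul_of_nonneg_right h4 (norm_nonneg v)
    rw [inner_sub_left] at h3
    linarith
  have h3 := h2 (Set.left_mem_Icc.2 zero_le_one) (Set.right_mem_Icc.2 zero_le_one) zero_le_one
  simp only [one_smul, zero_smul, add_zero] at h3
  linarith

theorem ConvexOn.add_inner_gradient_le (hf : ConvexOn ℝ Set.univ f)
    (hG : ∀ x, HasGradientAt f (G x) x) (x y : EuclideanSpace ℝ (Fin d)) :
    f x + inner ℝ (G x) (y - x) ≤ f y := by
  have h1 := hasDerivAt_comp_add_smul hG x (y - x) 0
  rw [zero_smul, add_zero] at h1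
  have hc : ConvexOn ℝ Set.univ fun s : ℝ => f (x + s • (y - x)) := by
    refine ⟨convex_univ, fun r _ s _ p q hp hq hpq => ?_⟩
    have h := hf.2 (Set.mem_univ (x + r • (y - x))) (Set.mem_univ (x + s • (y - x))) hp hq hpq
    convert h using 2
    have : p • (x + r • (y - x)) + q • (x + s • (y - x))
        = (p + q) • x + (p • r + q • s) • (y - x) := by
      simp only [smul_eq_mul]; module
    rw [this, hpq, one_smul]
  have h2 := hc.le_slope_of_hasDerivAt (Set.mem_univ 0) (Set.mem_univ 1) zero_lt_one h1
  simp [slope_def_field] at h2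
  linarith

/-- Strengthened gradient inequality for convex functions with `α`-Lipschitz gradient. -/
theorem ConvexOn.add_inner_gradient_add_sq_le (hα : 0 < α) (hf : ConvexOn ℝ Set.univ f)
    (hG : ∀ x, HasGradientAt f (G x) x) (hL : ∀ x y, ‖G x - G y‖ ≤ α * ‖x - y‖)
    (x y : EuclideanSpace ℝ (Fin d)) :
    f x + inner ℝ (G x) (y - x) + 1 / (2 * α) * ‖G x - G y‖ ^ 2 ≤ f y := by
  -- Compare the supporting plane at `x` with the upper quadratic at `y` in a gradient step from `y`.
  have h1 := hf.add_inner_gradient_le hG x (y + α⁻¹ • (G x - G y))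
  have h2 := le_add_inner_add_sq hG hL y (α⁻¹ • (G x - G y))
  have h3 : inner ℝ (G x) (α⁻¹ • (G x - G y)) - inner ℝ (G y) (α⁻¹ • (G x - G y))
      = α⁻¹ * ‖G x - G y‖ ^ 2 := by
    rw [← inner_sub_left, inner_smul_right, real_inner_self_eq_norm_sq]
  have h4 : α / 2 * ‖α⁻¹ • (G x - G y)‖ ^ 2 = 1 / (2 * α) * ‖G x - G y‖ ^ 2 := by
    rw [norm_smul, mul_pow, Real.norm_eq_abs, sq_abs]
    field_simp
  have h5 : α⁻¹ * ‖G x - G y‖ ^ 2 = 2 * (1 / (2 * α) * ‖G x - G y‖ ^ 2) := by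
    field_simp
  rw [show y + α⁻¹ • (G x - G y) - x = (y - x) + α⁻¹ • (G x - G y) by abel,
    inner_add_right] at h1
  linarith

theorem eq_gradient_of_mem_subdifferentialOn {x g : EuclideanSpace ℝ (Fin d)}
    (hG : HasGradientAt f (G x) x) (hg : g ∈ subdifferentialOn Set.univ f x) : g = G x := by
  have h1 : IsLocalMin (fun y => f y - inner ℝ g y) x := by
    refine Filter.Eventually.of_forall fun y => ?_
    have := hg y (Set.mem_univ y)
    rw [inner_sub_right] at this
    linarith
  have h2 : HasFDerivAt (fun y => f y - inner ℝ g y)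
      (InnerProductSpace.toDual ℝ _ (G x) - InnerProductSpace.toDual ℝ _ g) x :=
    hG.hasFDerivAt.sub (InnerProductSpace.toDual ℝ _ g).hasFDerivAt
  have h3 := h1.hasFDerivAt_eq_zero h2
  rw [sub_eq_zero] at h3
  exact ((InnerProductSpace.toDual ℝ _).injective h3).symm

theorem norm_gradient_le {M : ℝ} (hM : 0 ≤ M) (hf : ConvexOn ℝ Set.univ f)
    (hG : ∀ x, HasGradientAt f (G x) x) (hl : IsLipOn M Set.univ f)
    (x : EuclideanSpace ℝ (Fin d)) : ‖G x‖ ≤ M := by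
  have h1 := hf.add_inner_gradient_le hG x (x + G x)
  have h2 := (le_abs_self _).trans (hl (x + G x) (Set.mem_univ _) x (Set.mem_univ _))
  rw [add_sub_cancel_left, real_inner_self_eq_norm_sq] at h1
  rw [add_sub_cancel_left] at h2
  rcases (norm_nonneg (G x)).eq_or_lt with h0 | h0
  · rwa [← h0]
  · refine le_of_mul_le_mul_right ?_ h0
    linarith [sq ‖G x‖]

end SmoothConvex

/-! ### Estimates for the oracle answers -/

section Oracle

variable {d : ℕ} {α η R : ℝ} {f : EuclideanSpace ℝ (Fin d) → ℝ}
  {G : EuclideanSpace ℝ (Fin d) → EuclideanSpace ℝ (Fin d)}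

/-- An approximate first-order pair of `f` at a point of the ball defines an affine function that
exceeds `f` by `O(η)` on the ball at most, and by less where its slope is not the gradient. -/
theorem affine_add_sq_le (hα : 0 < α) (hR : 0 < R) (hη : 0 ≤ η) (hηR : 5 * η ≤ α * R ^ 2)
    (hf : ConvexOn ℝ Set.univ f) (hG : ∀ x, HasGradientAt f (G x) x)
    (hL : ∀ x y, ‖G x - G y‖ ≤ α * ‖x - y‖) {z x : EuclideanSpace ℝ (Fin d)}
    {p : FirstOrderPair d} (h1 : |p.1 - f z| ≤ η) (h2 : ‖p.2 - G z‖ ≤ η / (2 * R))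
    (hz : ‖z‖ ≤ R) (hx : ‖x‖ ≤ R) :
    p.1 + inner ℝ p.2 (x - z) + 1 / (4 * α) * ‖p.2 - G x‖ ^ 2 ≤ f x + 5 / 2 * η := by
  have h3 := hf.add_inner_gradient_add_sq_le hα hG hL z x
  have h4 : inner ℝ p.2 (x - z) ≤ inner ℝ (G z) (x - z) + η := by
    have h5 := real_inner_le_norm (p.2 - G z) (x - z)
    have h6 : ‖p.2 - G z‖ * ‖x - z‖ ≤ η / (2 * R) * (2 * R) := by
      gcongr
      exact (norm_sub_le _ _).trans (by linarith)
    rw [div_mul_cancel₀ _ (by positivity)] at h6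
    rw [inner_sub_left] at h5
    linarith
  have h5 : ‖p.2 - G x‖ ^ 2 ≤ 2 * ‖G z - G x‖ ^ 2 + 2 * (η / (2 * R)) ^ 2 := by
    have h6 : ‖p.2 - G x‖ ≤ η / (2 * R) + ‖G z - G x‖ :=
      (norm_sub_le_norm_sub_add_norm_sub _ (G z) _).trans (by linarith)
    have h7 := pow_le_pow_left₀ (norm_nonneg _) h6 2
    linarith [sq_nonneg (η / (2 * R) - ‖G z - G x‖)]
  have h6 := mul_le_mul_of_nonneg_left h5 (by positivity : 0 ≤ 1 / (4 * α))
  have h7 : 1 / (4 * α) * (2 * ‖G z - G x‖ ^ 2) = 1 / (2 * α) * ‖G z - G x‖ ^ 2 := by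
    field_simp
    norm_num
  have h8 : 1 / (4 * α) * (2 * (η / (2 * R)) ^ 2) ≤ η / 2 := by
    have e : 1 / (4 * α) * (2 * (η / (2 * R)) ^ 2) = η * η / (8 * (α * R ^ 2)) := by
      field_simp
      ring
    rw [e, div_le_iff₀ (by positivity)]
    nlinarith
  rw [mul_add] at h6
  have := (abs_le.1 h1).2
  linarith

/-- The reason why later affine functions do not affect the smooth maximum at an earlier point:
`l` and `l'` are the values at that point of an earlier and of a later affine function, `e` and `u`
the differences between their slopes and the gradient of `f`, and `D` is the difference between the
gradient of the smooth maximum and that of `f`. -/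
theorem penalized_le_penalized {E : Type*} [NormedAddCommGroup E] [InnerProductSpace ℝ E]
    {N q l l' F c c' : ℝ} {u D e : E} (hα : 0 < α) (hR : 0 < R) (hη : 0 ≤ η)
    (hq : 15 ≤ q) (hqN : 80 * N ≤ q ^ 2) (hc : c + 5 * η ≤ c')
    (hl : F - η - c ≤ l) (hl' : l' + 1 / (4 * α) * ‖u‖ ^ 2 ≤ F + 5 / 2 * η - c')
    (hD : ‖D‖ ^ 2 ≤ 20 * α * η * N) (hDR : ‖D‖ ≤ 2 * α * R) (he : ‖e‖ ≤ η / (2 * R)) :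
    l' + (α * q)⁻¹ / 2 * ‖u - D‖ ^ 2 ≤ l + (α * q)⁻¹ / 2 * ‖e - D‖ ^ 2 := by
  have hq0 : 0 < q := by linarith
  have h1 : ‖u - D‖ ^ 2 ≤ q / 2 * ‖u‖ ^ 2 + ‖D‖ ^ 2 + 4 / q * ‖D‖ ^ 2 := by
    have h2 := pow_le_pow_left₀ (norm_nonneg _) (norm_sub_le u D) 2
    have h3 : 0 ≤ q / 4 * (‖u‖ - 4 / q * ‖D‖) ^ 2 := by positivity
    have h4 : q / 4 * (‖u‖ - 4 / q * ‖D‖) ^ 2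
        = q / 4 * ‖u‖ ^ 2 - 2 * ‖u‖ * ‖D‖ + 4 / q * ‖D‖ ^ 2 := by
      field_simp
      ring
    nlinarith [sq_nonneg ‖u‖]
  have h2 : ‖D‖ ^ 2 - 2 * (η * α) ≤ ‖e - D‖ ^ 2 := by
    rw [norm_sub_sq_real]
    have h3 := real_inner_le_norm e D
    have h4 : ‖e‖ * ‖D‖ ≤ η / (2 * R) * (2 * α * R) := by gcongr
    have h5 : η / (2 * R) * (2 * α * R) = η * α := by field_simp
    linarith [sq_nonneg ‖e‖]
  have hμ : 0 ≤ (α * q)⁻¹ / 2 := by positivity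
  have h3 := mul_le_mul_of_nonneg_left h1 hμ
  have h4 := mul_le_mul_of_nonneg_left h2 hμ
  have h5 : (α * q)⁻¹ / 2 * (q / 2 * ‖u‖ ^ 2) = 1 / (4 * α) * ‖u‖ ^ 2 := by
    field_simp
    ring
  have h6 : (α * q)⁻¹ / 2 * (4 / q * ‖D‖ ^ 2) ≤ η / 2 := by
    have e1 : (α * q)⁻¹ / 2 * (4 / q * ‖D‖ ^ 2) = 2 * ‖D‖ ^ 2 / (α * q ^ 2) := by
      field_simp
      norm_num
    rw [e1, div_le_iff₀ (by positivity)]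
    have := mul_le_mul_of_nonneg_left hqN (by positivity : 0 ≤ η * α)
    linarith
  have h7 : (α * q)⁻¹ / 2 * (2 * (η * α)) ≤ η := by
    have e1 : (α * q)⁻¹ / 2 * (2 * (η * α)) = η / q := by field_simp
    rw [e1]
    exact div_le_self hη (by linarith)
  rw [mul_add, mul_add] at h3
  rw [mul_sub] at h4
  linarith

end Oracle

/-! ### The online procedure and its final family of affine functions -/

section Procedure

variable {d : ℕ}

/-- The value at the origin of the affine function given by the pair `p` at the point `z`, lowered
by `5 * η` for each of the `s` rounds before it. -/
noncomputable def loweredOffset (η : ℝ) (s : ℕ) (z : EuclideanSpace ℝ (Fin d))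
    (p : FirstOrderPair d) : ℝ :=
  p.1 - 5 * η * s - inner ℝ p.2 z

theorem loweredOffset_add_inner (η : ℝ) (s : ℕ) (z x : EuclideanSpace ℝ (Fin d))
    (p : FirstOrderPair d) :
    loweredOffset η s z p + inner ℝ p.2 x = p.1 + inner ℝ p.2 (x - z) - 5 * η * s := by
  rw [loweredOffset, inner_sub_right]
  ring

/-- The online procedure that outputs the value and the gradient, at the current point, of the
smooth maximum of the lowered affine functions received so far. -/
noncomputable def smoothMaxProcedure (d : ℕ) (μ η : ℝ) : OnlineProcedure d := fun t x p =>
  let a := fun i : Fin (t + 1) => loweredOffset η i (x i) (p i)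
  let g := fun i : Fin (t + 1) => (p i).2
  (smoothMax μ a g (x (Fin.last t)), smoothMaxGrad μ a g (x (Fin.last t)))

/-- Offsets of the tangents of `f`, lowered as in a round `T`, and of all affine functions received
in rounds `0, …, T - 1`. -/
noncomputable def finalOffset {T : ℕ} (η : ℝ) (f : EuclideanSpace ℝ (Fin d) → ℝ)
    (G : EuclideanSpace ℝ (Fin d) → EuclideanSpace ℝ (Fin d))
    (x : Fin T → EuclideanSpace ℝ (Fin d)) (p : Fin T → FirstOrderPair d) :
    EuclideanSpace ℝ (Fin d) ⊕ Fin T → ℝ :=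
  Sum.elim (fun z => loweredOffset η T z (f z, G z)) fun s => loweredOffset η s (x s) (p s)

/-- Slopes of the affine functions whose offsets are given by `finalOffset`. -/
def finalSlope {T : ℕ} (G : EuclideanSpace ℝ (Fin d) → EuclideanSpace ℝ (Fin d))
    (p : Fin T → FirstOrderPair d) :
    EuclideanSpace ℝ (Fin d) ⊕ Fin T → EuclideanSpace ℝ (Fin d) :=
  Sum.elim G fun s => (p s).2

variable {T : ℕ} {α η R : ℝ} {f : EuclideanSpace ℝ (Fin d) → ℝ}
  {G : EuclideanSpace ℝ (Fin d) → EuclideanSpace ℝ (Fin d)}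
  {x : Fin T → EuclideanSpace ℝ (Fin d)} {p : Fin T → FirstOrderPair d}

/-- The amount by which the members of the final family are lowered. -/
def finalDrop (η : ℝ) : EuclideanSpace ℝ (Fin d) ⊕ Fin T → ℝ :=
  Sum.elim (fun _ => 5 * η * T) fun s => 5 * η * (s : ℕ)

theorem finalDrop_nonneg (hη : 0 ≤ η) (k : EuclideanSpace ℝ (Fin d) ⊕ Fin T) :
    0 ≤ finalDrop η k := by
  rcases k with y | s <;> simp only [finalDrop, Sum.elim_inl, Sum.elim_inr] <;> positivity

theorem finalOffset_add_sq_le (hα : 0 < α) (hR : 0 < R) (hη : 0 ≤ η)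
    (hηT : 5 * η * T ≤ α * R ^ 2)
    (hf : ConvexOn ℝ Set.univ f) (hG : ∀ x, HasGradientAt f (G x) x)
    (hL : ∀ x y, ‖G x - G y‖ ≤ α * ‖x - y‖) (hx : ∀ t, ‖x t‖ ≤ R)
    (hp : ∀ t, |(p t).1 - f (x t)| ≤ η) (hp' : ∀ t, ‖(p t).2 - G (x t)‖ ≤ η / (2 * R))
    {z : EuclideanSpace ℝ (Fin d)} (hz : ‖z‖ ≤ R) (k : EuclideanSpace ℝ (Fin d) ⊕ Fin T) :
    finalOffset η f G x p k + inner ℝ (finalSlope G p k) z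
      + 1 / (4 * α) * ‖finalSlope G p k - G z‖ ^ 2 ≤ f z + 5 / 2 * η - finalDrop η k := by
  rcases k with y | s
  · have h := hf.add_inner_gradient_add_sq_le hα hG hL y z
    have e := loweredOffset_add_inner η T y z (f y, G y)
    have h2 : 1 / (4 * α) * ‖G y - G z‖ ^ 2 ≤ 1 / (2 * α) * ‖G y - G z‖ ^ 2 := by
      gcongr
      norm_num
    simp only [finalOffset, finalSlope, finalDrop, Sum.elim_inl] at e ⊢
    linarith
  · have hT : (1 : ℝ) ≤ T := by exact_mod_cast s.pos
    have h := affine_add_sq_le hα hR hη (by nlinarith) hf hG hL (hp s) (hp' s) (hx s) hz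
    have e := loweredOffset_add_inner η s (x s) z (p s)
    simp only [finalOffset, finalSlope, finalDrop, Sum.elim_inr] at e ⊢
    linarith

theorem norm_finalSlope_le {M : ℝ} (hη : 0 ≤ η / (2 * R)) (hM : ∀ z, ‖G z‖ ≤ M)
    (hp' : ∀ t, ‖(p t).2 - G (x t)‖ ≤ η / (2 * R)) (k : EuclideanSpace ℝ (Fin d) ⊕ Fin T) :
    ‖finalSlope G p k‖ ≤ M + η / (2 * R) := by
  rcases k with y | s
  · exact (hM y).trans (by linarith)
  · have h := norm_le_norm_add_norm_sub' (p s).2 (G (x s))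
    exact h.trans (by linarith [hM (x s), hp' s])

end Procedure

/-! ### Consistency of the online outputs with the final smooth maximum -/

section Consistency

variable {d T : ℕ} {α η R q : ℝ} {f : EuclideanSpace ℝ (Fin d) → ℝ}
  {G : EuclideanSpace ℝ (Fin d) → EuclideanSpace ℝ (Fin d)}
  {x : Fin T → EuclideanSpace ℝ (Fin d)}

theorem isPenaltyBounded_final {μ M : ℝ} {p : Fin T → FirstOrderPair d} (hμ : 0 ≤ μ)
    (hα : 0 < α) (hR : 0 < R) (hη : 0 ≤ η) (hηT : 5 * η * T ≤ α * R ^ 2)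
    (hf : ConvexOn ℝ Set.univ f) (hG : ∀ x, HasGradientAt f (G x) x)
    (hL : ∀ x y, ‖G x - G y‖ ≤ α * ‖x - y‖) (hM : ∀ z, ‖G z‖ ≤ M) (hx : ∀ t, ‖x t‖ ≤ R)
    (hp : ∀ t, |(p t).1 - f (x t)| ≤ η) (hp' : ∀ t, ‖(p t).2 - G (x t)‖ ≤ η / (2 * R)) :
    IsPenaltyBounded μ (finalOffset η f G x p) (finalSlope G p) := by
  refine isPenaltyBounded_of_norm_le hμ (B := f 0 + 5 / 2 * η)
    (norm_finalSlope_le (by positivity) hM hp') fun k => ?_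
  have h := finalOffset_add_sq_le hα hR hη hηT hf hG hL hx hp hp' (norm_zero.trans_le hR.le) k
  rw [inner_zero_right] at h
  have h2 : 0 ≤ 1 / (4 * α) * ‖finalSlope G p k - G 0‖ ^ 2 := by positivity
  have h3 := finalDrop_nonneg hη k
  linarith

/-- The pair put out in round `t`, which is computed from the first `t + 1` answers only, consists of
the value and the gradient of the final smooth maximum. -/
theorem smoothMax_final_eq_output {M : ℝ}
    {O : Fin T → EuclideanSpace ℝ (Fin d) → FirstOrderPair d}
    (hα : 0 < α) (hR : 0 < R) (hη : 0 ≤ η) (hηT : 5 * η * T ≤ α * R ^ 2)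
    (hq : 15 ≤ q) (hqT : 80 * T ≤ q ^ 2)
    (hf : ConvexOn ℝ Set.univ f) (hG : ∀ x, HasGradientAt f (G x) x)
    (hL : ∀ x y, ‖G x - G y‖ ≤ α * ‖x - y‖) (hM : ∀ z, ‖G z‖ ≤ M) (hx : ∀ t, ‖x t‖ ≤ R)
    (hp : ∀ t, |(O t (x t)).1 - f (x t)| ≤ η)
    (hp' : ∀ t, ‖(O t (x t)).2 - G (x t)‖ ≤ η / (2 * R)) (t : Fin T) :
    let S := smoothMax (α * q)⁻¹ (finalOffset η f G x fun t => O t (x t))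
      (finalSlope G fun t => O t (x t))
    let S' := smoothMaxGrad (α * q)⁻¹ (finalOffset η f G x fun t => O t (x t))
      (finalSlope G fun t => O t (x t))
    S (x t) = ((smoothMaxProcedure d (α * q)⁻¹ η).output x O t).1 ∧
      S' (x t) = ((smoothMaxProcedure d (α * q)⁻¹ η).output x O t).2 := by
  intro S S'
  have hq0 : 0 < q := by linarith
  have hμ : 0 < (α * q)⁻¹ := by positivity
  set e : Fin (t + 1) → EuclideanSpace ℝ (Fin d) ⊕ Fin T :=
    fun i => Sum.inr (Fin.castLE t.isLt i)
  set p : Fin T → FirstOrderPair d := fun t => O t (x t) with hpdef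
  set a : Fin (t + 1) → ℝ := fun i => finalOffset η f G x p (e i) with ha
  set g : Fin (t + 1) → EuclideanSpace ℝ (Fin d) := fun i => finalSlope G p (e i) with hg
  have hlast : e (Fin.last t) = Sum.inr t := rfl
  have hb : IsPenaltyBounded (α * q)⁻¹ a g := isPenaltyBounded_of_finite
  have hb' : IsPenaltyBounded (α * q)⁻¹ (finalOffset η f G x p) (finalSlope G p) :=
    isPenaltyBounded_final hμ.le hα hR hη hηT hf hG hL hM hx hp hp'
  change S (x t) = smoothMax (α * q)⁻¹ a g (x t) ∧ S' (x t) = smoothMaxGrad (α * q)⁻¹ a g (x t)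
  have hpiece := finalOffset_add_sq_le hα hR hη hηT hf hG hL hx hp hp' (hx t)
  -- The affine function received in round `t`, at the point of that round.
  have hcur : a (Fin.last t) + inner ℝ (g (Fin.last t)) (x t)
      = (p t).1 - 5 * η * (t : ℕ) := by
    have h := loweredOffset_add_inner η t (x t) (x t) (p t)
    rw [sub_self, inner_zero_right, add_zero] at h
    exact h
  have hF : f (x t) - η - 5 * η * (t : ℕ) ≤ a (Fin.last t) + inner ℝ (g (Fin.last t)) (x t) := by
    rw [hcur]
    linarith [(abs_le.1 (hp t)).1]
  have htT : ((t : ℕ) : ℝ) + 1 ≤ T := by exact_mod_cast t.isLt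
  set D := smoothMaxGrad (α * q)⁻¹ a g (x t) - G (x t) with hD
  have hD1 : ‖D‖ ^ 2 ≤ 20 * α * η * T := by
    have h1 : smoothMax (α * q)⁻¹ a g (x t) + 1 / (2 * α) / 2 * ‖D‖ ^ 2 ≤
        f (x t) + 5 / 2 * η := by
      refine smoothMax_add_sq_le hμ hb ?_ fun i => ?_
      · rw [one_div]
        gcongr ?_⁻¹
        nlinarith
      · have h2 := hpiece (e i)
        have h3 := finalDrop_nonneg hη (e i)
        rw [div_div, show 2 * α * 2 = 4 * α by ring]
        linarith
    have h2 := le_smoothMax hμ hb (x t) (Fin.last t)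
    have h3 : 1 / (2 * α) / 2 * ‖D‖ ^ 2 ≤ 5 * η * T := by
      have := mul_le_mul_of_nonneg_left htT hη
      linarith
    rw [div_div, one_div_mul_eq_div, div_le_iff₀ (by positivity)] at h3
    linarith
  have hD2 : ‖D‖ ≤ 2 * α * R := by
    refine le_of_sq_le_sq ?_ (by positivity)
    have := mul_le_mul_of_nonneg_left hηT (by positivity : 0 ≤ 4 * α)
    linarith
  refine smoothMax_eq_of_subfamily hμ hb hb' e (fun _ => rfl) (fun _ => rfl) fun k => ?_
  have hlater : 5 * η * (t : ℕ) + 5 * η ≤ finalDrop η k →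
      finalOffset η f G x p k + inner ℝ (finalSlope G p k) (x t) + (α * q)⁻¹ / 2
        * ‖finalSlope G p k - smoothMaxGrad (α * q)⁻¹ a g (x t)‖ ^ 2
        ≤ smoothMax (α * q)⁻¹ a g (x t) := by
    intro hk
    have h1 := penalized_le_penalized hα hR hη hq hqT hk hF (hpiece k) hD1 hD2 (hp' t)
    refine le_trans ?_ (le_penalizedSup hb (x t) _ (Fin.last t))
    rw [hD, sub_sub_sub_cancel_right, sub_sub_sub_cancel_right] at h1
    exact h1
  rcases k with z | s
  · refine hlater ?_
    have := mul_le_mul_of_nonneg_left htT hη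
    simp only [finalDrop, Sum.elim_inl]
    linarith
  · rcases le_or_gt s t with hst | hst
    · exact le_penalizedSup hb (x t) _ ⟨s, Nat.lt_succ_of_le hst⟩
    · refine hlater ?_
      have h1 : ((t : ℕ) : ℝ) + 1 ≤ (s : ℕ) := by exact_mod_cast hst
      have := mul_le_mul_of_nonneg_left h1 hη
      simp only [finalDrop, Sum.elim_inr]
      linarith

end Consistency

/-! ### The extension theorem -/

section Extension

variable {d T : ℕ} {α M η R : ℝ} {f : EuclideanSpace ℝ (Fin d) → ℝ}

theorem IsLipOn.max_zero {s : Set (EuclideanSpace ℝ (Fin d))} (h : IsLipOn M s f) :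
    IsLipOn (max M 0) s f := fun x hx y hy =>
  (h x hx y hy).trans (mul_le_mul_of_nonneg_right (le_max_left _ _) (norm_nonneg _))

/-- A Lipschitz constant of a function on the whole space can be negative only on a one-point
space, where every constant will do. -/
theorem IsLipOn.of_max_zero_add (hf : IsLipOn M Set.univ f) {c : ℝ}
    {s : Set (EuclideanSpace ℝ (Fin d))} {h : EuclideanSpace ℝ (Fin d) → ℝ}
    (hh : IsLipOn (max M 0 + c) s h) : IsLipOn (M + c) s h := by
  intro x hx y hy
  rcases eq_or_ne x y with rfl | hxy
  · simp
  · have h1 := (abs_nonneg _).trans (hf x (Set.mem_univ _) y (Set.mem_univ _))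
    have h2 : 0 ≤ M := nonneg_of_mul_nonneg_left h1 (norm_pos_iff.2 (sub_ne_zero.2 hxy))
    have h3 := hh x hx y hy
    rwa [max_eq_left h2] at h3

theorem mul_norm_sub_le_sqrt_mul {q : ℝ} (hq : 1 ≤ q) (x y : EuclideanSpace ℝ (Fin d))
    (h : 0 ≤ α * ‖x - y‖) : α * ‖x - y‖ * q ≤ α * √(d : ℝ) * q * ‖x - y‖ := by
  rcases Nat.eq_zero_or_pos d with rfl | hd
  · simp [Subsingleton.elim x y]
  · have h1 : 1 ≤ √(d : ℝ) := Real.one_le_sqrt.2 (by exact_mod_cast hd)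
    have h2 := mul_le_mul_of_nonneg_left h1 (mul_nonneg h (by linarith : 0 ≤ q))
    linarith

end Extension

theorem theorem6 (d T : ℕ) (α M R η : ℝ) (hR : 0 < R) (hη : 0 ≤ η)
    (hηT : η ≤ α * R ^ 2 / (5 * (T : ℝ))) :
    ∃ P : OnlineProcedure d,
      ∀ f : EuclideanSpace ℝ (Fin d) → ℝ,
        IsSmoothOn α Set.univ f → IsLipOn M Set.univ f → ConvexOn ℝ Set.univ f →
      ∀ x : Fin T → EuclideanSpace ℝ (Fin d), (∀ t, x t ∈ Metric.closedBall 0 R) →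
      ∀ O : Fin T → EuclideanSpace ℝ (Fin d) → FirstOrderPair d,
        (∀ t, IsApproxOracle η R f (O t)) →
      ∃ S : EuclideanSpace ℝ (Fin d) → ℝ,
        IsLipConvexExtension (M + η / (2 * R)) (Metric.closedBall 0 R) x (P.output x O) S ∧
        IsSmoothOn (α * √(d : ℝ) * (4 * √(5 * ((T : ℝ) + 1)) + 3)) (Metric.closedBall 0 R) S ∧
        (∀ t, HasGradientWithinAt S (P.output x O t).2 (Metric.closedBall 0 R) (x t)) ∧
        ∀ z ∈ Metric.closedBall (0 : EuclideanSpace ℝ (Fin d)) R,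
          |S z - f z| ≤ 5 * η * ((T : ℝ) + 2) := by
  set q : ℝ := 4 * √(5 * ((T : ℝ) + 1)) + 3 with hq
  have hsq : √(5 * ((T : ℝ) + 1)) ^ 2 = 5 * ((T : ℝ) + 1) := Real.sq_sqrt (by positivity)
  have hq3 : 3 ≤ q := by rw [hq]; linarith [Real.sqrt_nonneg (5 * ((T : ℝ) + 1))]
  have hqT : 80 * (T : ℝ) ≤ q ^ 2 := by nlinarith [Real.sqrt_nonneg (5 * ((T : ℝ) + 1))]
  rcases hη.eq_or_lt with rfl | hη0
  · -- The oracle is exact, so that `f` itself is the extension.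
    refine ⟨fun t _ p => p (Fin.last t), fun f hs hl hf x hx O hO => ⟨f, ?_, ?_, ?_, ?_⟩⟩
    all_goals obtain ⟨G, hG, hL⟩ := hs
    · have hval : ∀ t, (O t (x t)).1 = f (x t) := fun t =>
        sub_eq_zero.1 (abs_nonpos_iff.1 (hO t (x t)).1)
      refine ⟨hf.subset (Set.subset_univ _) (convex_closedBall _ _), ?_, ?_, ?_⟩
      · intro y _ z _
        simpa using hl y (Set.mem_univ _) z (Set.mem_univ _)
      · exact fun t => (hval t).symm
      · intro t y _
        obtain ⟨g, hg, hgO⟩ := (hO t (x t)).2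
        have h1 : (O t (x t)).2 = g := by simpa [sub_eq_zero] using hgO
        exact h1 ▸ hg y (Set.mem_univ _)
    · refine ⟨G, fun y _ =>
        (hG y (Set.mem_univ _)).hasFDerivWithinAt.mono (Set.subset_univ _), fun y _ z _ => ?_⟩
      have h1 := hL y (Set.mem_univ _) z (Set.mem_univ _)
      have h2 := (norm_nonneg _).trans h1
      refine h1.trans (le_trans ?_ (mul_norm_sub_le_sqrt_mul (by linarith) y z h2))
      exact le_mul_of_one_le_right h2 (by linarith)
    · intro t
      obtain ⟨g, hg, hgO⟩ := (hO t (x t)).2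
      have h1 : (O t (x t)).2 = g := by simpa [sub_eq_zero] using hgO
      have h2 := hG (x t) (Set.mem_univ _)
      have h3 := eq_gradient_of_mem_subdifferentialOn (hasGradientWithinAt_univ.1 h2) hg
      change HasGradientWithinAt f (O t (x t)).2 _ _
      rw [h1, h3]
      exact h2.hasFDerivWithinAt.mono (Set.subset_univ _)
    · simp
  · -- For `T = 0` the bound on `η` divides by zero and forces `η = 0`.
    have hT : 0 < (T : ℝ) := by
      rcases Nat.eq_zero_or_pos T with rfl | h
      · simp at hηT
        linarith
      · exact_mod_cast h
    rw [le_div_iff₀ (by positivity)] at hηT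
    have hα : 0 < α := by
      have : 0 < α * R ^ 2 := lt_of_lt_of_le (by positivity) hηT
      exact pos_of_mul_pos_left this (by positivity)
    have hηT' : 5 * η * T ≤ α * R ^ 2 := by linarith
    have hq15 : 15 ≤ q := by
      have h1 : (1 : ℝ) ≤ T := by exact_mod_cast hT
      have : (3 : ℝ) ≤ √(5 * ((T : ℝ) + 1)) := Real.le_sqrt_of_sq_le (by linarith)
      rw [hq]; linarith
    have hq0 : 0 < q := by linarith
    have hμ : 0 < (α * q)⁻¹ := by positivity
    refine ⟨smoothMaxProcedure d (α * q)⁻¹ η, fun f hs hl hf x hx O hO => ?_⟩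
    obtain ⟨G, hG, hL⟩ := hs
    replace hG : ∀ y, HasGradientAt f (G y) y := fun y =>
      hasGradientWithinAt_univ.1 (hG y (Set.mem_univ _))
    replace hL : ∀ y z, ‖G y - G z‖ ≤ α * ‖y - z‖ := fun y z =>
      hL y (Set.mem_univ _) z (Set.mem_univ _)
    have hM : ∀ z, ‖G z‖ ≤ max M 0 := norm_gradient_le (le_max_right _ _) hf hG hl.max_zero
    replace hx : ∀ t, ‖x t‖ ≤ R := fun t => mem_closedBall_zero_iff.1 (hx t)
    have hp : ∀ t, |(O t (x t)).1 - f (x t)| ≤ η := fun t => (hO t (x t)).1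
    have hp' : ∀ t, ‖(O t (x t)).2 - G (x t)‖ ≤ η / (2 * R) := fun t => by
      obtain ⟨g, hg, hgO⟩ := (hO t (x t)).2
      rwa [eq_gradient_of_mem_subdifferentialOn (hG (x t)) hg] at hgO
    have hb := isPenaltyBounded_final hμ.le hα hR hη hηT' hf hG hL hM hx hp hp'
    have hout := smoothMax_final_eq_output hα hR hη hηT' hq15 hqT hf hG hL hM hx hp hp'
    set a := finalOffset η f G x fun t => O t (x t) with ha
    set g := finalSlope G fun t => O t (x t) with hg
    refine ⟨smoothMax (α * q)⁻¹ a g, ⟨?_, ?_, fun t => (hout t).1, ?_⟩, ?_, ?_, ?_⟩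
    · exact (convexOn_smoothMax hμ hb).subset (Set.subset_univ _) (convex_closedBall _ _)
    · exact hl.of_max_zero_add fun y _ z _ => abs_smoothMax_sub_le hμ hb
        (norm_finalSlope_le (by positivity) hM hp') y z
    · intro t y _
      rw [← (hout t).2]
      exact smoothMax_add_inner_le hμ hb (x t) y
    · refine ⟨smoothMaxGrad (α * q)⁻¹ a g, fun y _ =>
        (hasGradientAt_smoothMax hμ hb y).hasFDerivAt.hasFDerivWithinAt, fun y _ z _ => ?_⟩
      have h1 := norm_smoothMaxGrad_sub_le hμ hb y z
      rw [inv_inv] at h1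
      have h2 := mul_norm_sub_le_sqrt_mul (by linarith : 1 ≤ q) y z
        (by positivity : 0 ≤ α * ‖y - z‖)
      linarith
    · intro t
      rw [← (hout t).2]
      exact (hasGradientAt_smoothMax hμ hb (x t)).hasFDerivAt.hasFDerivWithinAt
    · intro z hz
      have h1 := le_smoothMax hμ hb z (Sum.inl z)
      have e := loweredOffset_add_inner η T z z (f z, G z)
      rw [sub_self, inner_zero_right, add_zero] at e
      change loweredOffset η T z (f z, G z) + inner ℝ (G z) z ≤ _ at h1
      have h2 : smoothMax (α * q)⁻¹ a g z ≤ f z + 5 / 2 * η := by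
        refine (smoothMax_le_penalizedSup hμ hb z (G z)).trans (penalizedSup_le fun k => ?_)
        have h3 := finalOffset_add_sq_le hα hR hη hηT' hf hG hL hx hp hp'
          (mem_closedBall_zero_iff.1 hz) k
        have h4 := finalDrop_nonneg hη k
        have h5 : (α * q)⁻¹ / 2 * ‖g k - G z‖ ^ 2 ≤ 1 / (4 * α) * ‖g k - G z‖ ^ 2 := by
          refine mul_le_mul_of_nonneg_right ?_ (sq_nonneg _)
          rw [div_le_div_iff₀ (by positivity) (by positivity)]
          field_simp
          linarith
        linarith
      have h6 : 0 ≤ η * T := by positivity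
      dsimp only at e
      rw [abs_le]
      constructor <;> linarith
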